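/- Let $n\ge 1$ be an integer, let $r>0$, and let $B_r\subset\mathbb R^n$ be the open ball of radius $r$ centered at the origin. Write $du$ for the $\mathbb R^n$-gradient of $u(\cdot,t)$ and $\operatorname{div}$ for the divergence in $\mathbb R^n$. Suppose that the graph of $u:B_r\times[0,r^2]\to\mathbb R$ flows by mean curvature, i.e. $u$ is continuous on $B_r\times[0,r^2]$, smooth on $B_r\times(0,r^2)$, and satisfies there $$u_t=(1+|du|^2)^{1/2}\,\operatorname{div}\left(\frac{du}{(1+|du|^2)^{1/2}}\right).$$ Then $$\log\left(1+|du|^2\left(0,\tfrac{r^2}{4n}\right)\right)\le 2\log 10+16\,n\,\left(1+2\,r^{-1}\,\|u\|_\infty\right)^2,$$ where $\|u\|_\infty=\sup_{B_r\times[0,r^2]}|u|\in[0,\infty]$ (if it is infinite, the right-hand side is $\infty$). -/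

import Mathlib

open Set
open scoped ContDiff ENNReal

namespace GraphMCF

/-- The Euclidean divergence `∑ i, ∂ᵢ Fᵢ` at `x` of a vector field `F` on `ℝⁿ`. -/
noncomputable def euclideanDiv {n : ℕ}
    (F : EuclideanSpace ℝ (Fin n) → EuclideanSpace ℝ (Fin n))
    (x : EuclideanSpace ℝ (Fin n)) : ℝ :=
  ∑ i, (fderiv ℝ F x (EuclideanSpace.single i 1)) i

/-- The volume element `(1 + |df|²)^{1/2}` of the graph of `f`. -/
noncomputable def volumeElement {n : ℕ} (f : EuclideanSpace ℝ (Fin n) → ℝ)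
    (x : EuclideanSpace ℝ (Fin n)) : ℝ :=
  Real.sqrt (1 + ‖gradient f x‖ ^ 2)

/-- The graph of `u : B_r × [0, r²] → ℝ` flows by mean curvature: `u` is continuous on
`B_r × [0, r²]` (with `B_r` the open ball), smooth on the open cylinder `B_r × (0, r²)`, and there
`u_t = (1 + |du|²)^{1/2} div (du / (1 + |du|²)^{1/2})`.
A `u` that is smooth up to the times `0` and `r²` is a special case. Values of `u` outside
`B_r × [0, r²]` play no role. -/
structure GraphFlowsByMeanCurvature {n : ℕ} (r : ℝ)
    (u : EuclideanSpace ℝ (Fin n) → ℝ → ℝ) : Prop where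
  continuousOn : ContinuousOn (fun p : EuclideanSpace ℝ (Fin n) × ℝ => u p.1 p.2)
    (Metric.ball 0 r ×ˢ Icc 0 (r ^ 2))
  contDiffOn : ContDiffOn ℝ ∞ (fun p : EuclideanSpace ℝ (Fin n) × ℝ => u p.1 p.2)
    (Metric.ball 0 r ×ˢ Ioo 0 (r ^ 2))
  equation : ∀ x ∈ Metric.ball (0 : EuclideanSpace ℝ (Fin n)) r, ∀ t ∈ Ioo 0 (r ^ 2),
    deriv (fun s => u x s) t =
      volumeElement (fun z => u z t) x *
        euclideanDiv (fun z => (volumeElement (fun w => u w t) z)⁻¹ •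
          gradient (fun w => u w t) z) x

/-- The sup norm of `u` over `B_r × [0, r²]`, with value `∞` when `u` is unbounded there. -/
noncomputable def supNorm {n : ℕ} (r : ℝ) (u : EuclideanSpace ℝ (Fin n) → ℝ → ℝ) : ℝ≥0∞ :=
  ⨆ x ∈ Metric.ball (0 : EuclideanSpace ℝ (Fin n)) r, ⨆ t ∈ Icc 0 (r ^ 2), ENNReal.ofReal |u x t|

end GraphMCF

/-! Let `v = (1 + |du|²)^{1/2}`, and let `φ` be `α u` plus a barrier that makes `φ` negative near
the parabolic boundary. At a positive maximum `z` of `(e^{Kφ} - 1) v`, put `p = du(z)` and freeze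
the coefficients of the heat operator `∂ₜ - gⁱʲ ∂ᵢ ∂ⱼ` of the graph at `p`. By Cauchy-Schwarz `1 +
⟨p, du⟩ ≤ (1 + |p|²)^{1/2} v`, with equality at `z`, so `e^{Kφ} - 1` minus a positive multiple of
`(1 + ⟨p, du⟩)⁻¹` has a maximum at `z` as well. Differentiating the equation in the direction `p`
shows that the frozen operator annihilates `(1 + ⟨p, du⟩)⁻¹` at `z`; hence it is nonnegative on
`e^{Kφ} - 1` there, that is, `K |dφ|²` in the metric of the graph is at most the frozen operator
applied to `φ`. To the latter only the barrier contributes, while `|dφ|²` stays away from `0` for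
large `p`, so that a large `K` bounds `|p|` by a multiple of `1 + 2 ‖u‖_∞ / r`. -/

namespace GraphMCF

open Filter Function
open scoped Gradient Topology

section Calculus

variable {E : Type*} [NormedAddCommGroup E] [NormedSpace ℝ E] {f g : E → ℝ} {x : E}

/-- The second derivative of `f`, as a bilinear form. -/
noncomputable def hessian (f : E → ℝ) (x : E) : E →L[ℝ] E →L[ℝ] ℝ :=
  fderiv ℝ (fderiv ℝ f) x

theorem hasFDerivAt_fderiv (hf : ContDiffAt ℝ 2 f x) :
    HasFDerivAt (fderiv ℝ f) (hessian f x) x :=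
  ((hf.fderiv_right (m := 1) (by norm_num)).differentiableAt one_ne_zero).hasFDerivAt

theorem hessian_comm (hf : ContDiffAt ℝ 2 f x) (v w : E) : hessian f x v w = hessian f x w v :=
  hf.isSymmSndFDerivAt (by simp) v w

theorem hessian_eq_of_eventually_hasFDerivAt {f' : E → E →L[ℝ] ℝ} {B : E →L[ℝ] E →L[ℝ] ℝ}
    (hf : ∀ᶠ y in 𝓝 x, HasFDerivAt f (f' y) y) (hB : HasFDerivAt f' B x) : hessian f x = B :=
  (hB.congr_of_eventuallyEq (hf.mono fun _ hy => hy.fderiv)).fderiv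

theorem eventually_hasFDerivAt (hf : ContDiffAt ℝ 2 f x) :
    ∀ᶠ y in 𝓝 x, HasFDerivAt f (fderiv ℝ f y) y :=
  (hf.eventually (by simp)).mono fun _ hy => (hy.differentiableAt two_ne_zero).hasFDerivAt

theorem hessian_add_const_mul (hf : ContDiffAt ℝ 2 f x) (hg : ContDiffAt ℝ 2 g x) (c : ℝ) :
    hessian (fun y => f y + c * g y) x = hessian f x + c • hessian g x := by
  refine hessian_eq_of_eventually_hasFDerivAt (f' := fun y => fderiv ℝ f y + c • fderiv ℝ g y) ?_
    ((hasFDerivAt_fderiv hf).add ((hasFDerivAt_fderiv hg).const_smul c))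
  filter_upwards [eventually_hasFDerivAt hf, eventually_hasFDerivAt hg] with y hfy hgy
  exact hfy.add (hgy.const_mul c)

theorem hessian_comp {ψ ψ' : ℝ → ℝ} {ψ'' : ℝ} (hψ : ∀ᶠ s in 𝓝 (f x), HasDerivAt ψ (ψ' s) s)
    (hψ' : HasDerivAt ψ' ψ'' (f x)) (hf : ContDiffAt ℝ 2 f x) :
    hessian (fun y => ψ (f y)) x =
      ψ' (f x) • hessian f x + ψ'' • (fderiv ℝ f x).smulRight (fderiv ℝ f x) := by
  have hfx := hf.differentiableAt two_ne_zero
  refine hessian_eq_of_eventually_hasFDerivAt (f' := fun y => ψ' (f y) • fderiv ℝ f y) ?_ ?_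
  · filter_upwards [eventually_hasFDerivAt hf, hfx.continuousAt.eventually hψ] with y hfy hψy
    exact hψy.comp_hasFDerivAt y hfy
  · refine ((hψ'.comp_hasFDerivAt x hfx.hasFDerivAt).fun_smul
      (hasFDerivAt_fderiv hf)).congr_fderiv ?_
    ext v w
    simp [mul_assoc]

theorem fderiv_fderiv_apply (hf : ContDiffAt ℝ 2 f x) (v w : E) :
    fderiv ℝ (fun y => fderiv ℝ f y w) x v = hessian f x v w := by
  simp [((hasFDerivAt_fderiv hf).clm_apply (hasFDerivAt_const w x)).fderiv]

theorem differentiableAt_hessian (hf : ContDiffAt ℝ 3 f x) : DifferentiableAt ℝ (hessian f) x :=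
  ((hf.fderiv_right (m := 2) (by norm_num)).fderiv_right
    (m := 1) (by norm_num)).differentiableAt one_ne_zero

theorem hessian_fderiv_apply (hf : ContDiffAt ℝ 3 f x) (v : E) :
    hessian (fun y => fderiv ℝ f y v) x = fderiv ℝ (hessian f) x v := by
  have hf' : ContDiffAt ℝ 2 (fderiv ℝ f) x := hf.fderiv_right (by norm_num)
  refine hessian_eq_of_eventually_hasFDerivAt (f' := fun y => hessian f y v) ?_ ?_
  · filter_upwards [hf.eventually (by simp)] with y hy
    have hy : ContDiffAt ℝ 2 f y := hy.of_le (by norm_num)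
    refine ((hasFDerivAt_fderiv hy).clm_apply (hasFDerivAt_const v y)).congr_fderiv ?_
    ext w
    simpa using hessian_comm hy w v
  · refine ((differentiableAt_hessian hf).hasFDerivAt.clm_apply
      (hasFDerivAt_const v x)).congr_fderiv ?_
    ext w : 1
    have hsymm : IsSymmSndFDerivAt ℝ (fderiv ℝ f) x := hf'.isSymmSndFDerivAt (by simp)
    simpa using! hsymm w v

theorem deriv_deriv_nonpos_of_isLocalMax {h : ℝ → ℝ} {s : ℝ} (hs : IsLocalMax h s)
    (hc : ContinuousAt h s) : deriv (deriv h) s ≤ 0 := by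
  by_contra! hpos
  have hmin : IsLocalMin h s := isLocalMin_of_deriv_deriv_pos hpos hs.deriv_eq_zero hc
  have hconst : h =ᶠ[𝓝 s] fun _ => h s := by
    filter_upwards [hs, hmin] with y hle hge using le_antisymm hle hge
  have hzero := hconst.deriv.deriv_eq
  simp only [deriv_const'] at hzero
  exact hpos.ne' hzero

theorem hessian_nonpos_of_isLocalMax (hf : ContDiffAt ℝ 2 f x) (h : IsLocalMax f x) (v : E) :
    hessian f x v v ≤ 0 := by
  have hline (s : ℝ) : HasDerivAt (fun s => x + s • v) v s := by
    simpa only [id, one_smul] using ((hasDerivAt_id s).smul_const v).const_add x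
  have htendsto : Tendsto (fun s : ℝ => x + s • v) (𝓝 0) (𝓝 x) :=
    Continuous.tendsto' (by fun_prop) _ _ (by simp)
  have hderiv : deriv (fun s : ℝ => f (x + s • v)) =ᶠ[𝓝 0] fun s => fderiv ℝ f (x + s • v) v := by
    filter_upwards [htendsto.eventually (eventually_hasFDerivAt hf)] with s hs
    exact (hs.comp_hasDerivAt s (hline s)).deriv
  have hderiv2 : HasDerivAt (fun s : ℝ => fderiv ℝ f (x + s • v) v) (hessian f x v v) 0 := by
    have h : HasLineDerivAt ℝ (fderiv ℝ f) (hessian f x v) x v :=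
      (hasFDerivAt_fderiv hf).hasLineDerivAt v
    simpa using HasDerivAt.clm_apply h (hasDerivAt_const 0 v)
  rw [← hderiv2.deriv, ← hderiv.deriv_eq]
  refine deriv_deriv_nonpos_of_isLocalMax ?_ ?_
  · filter_upwards [htendsto.eventually h] with s hs
    simpa using hs
  · exact ContinuousAt.comp (by simpa using hf.continuousAt) (hline 0).continuousAt

variable {u : E → ℝ → ℝ} {t : ℝ}

theorem contDiffAt_slice {k : ℕ∞ω} (hu : ContDiffAt ℝ k (uncurry u) (x, t)) :
    ContDiffAt ℝ k (u · t) x :=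
  hu.comp (f := fun y => (y, t)) x (contDiffAt_id.prodMk contDiffAt_const)

theorem hasFDerivAt_slice {F : E × ℝ → ℝ} {F' : E × ℝ →L[ℝ] ℝ} (hF : HasFDerivAt F F' (x, t)) :
    HasFDerivAt (fun y => F (y, t)) (F'.comp (ContinuousLinearMap.inl ℝ E ℝ)) x :=
  HasFDerivAt.comp (f := fun y => (y, t)) x hF (hasFDerivAt_prodMk_left x t)

theorem fderiv_slice (hu : DifferentiableAt ℝ (uncurry u) (x, t)) (v : E) :
    fderiv ℝ (u · t) x v = fderiv ℝ (uncurry u) (x, t) (v, 0) := by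
  have h : HasFDerivAt (u · t) _ x := hasFDerivAt_slice hu.hasFDerivAt
  simp [h.fderiv]

theorem hasDerivAt_slice (hu : DifferentiableAt ℝ (uncurry u) (x, t)) :
    HasDerivAt (u x) (fderiv ℝ (uncurry u) (x, t) (0, 1)) t :=
  hu.hasFDerivAt.comp_hasDerivAt t ((hasDerivAt_const t x).prodMk (hasDerivAt_id t))

theorem uncurry_fderiv_eventuallyEq (hu : ContDiffAt ℝ 2 (uncurry u) (x, t)) (v : E) :
    uncurry (fun y s => fderiv ℝ (u · s) y v) =ᶠ[𝓝 (x, t)]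
      fun q => fderiv ℝ (uncurry u) q (v, 0) :=
  (eventually_hasFDerivAt hu).mono fun _ hq => fderiv_slice hq.differentiableAt v

theorem contDiffAt_uncurry_fderiv (hu : ContDiffAt ℝ 3 (uncurry u) (x, t)) (v : E) :
    ContDiffAt ℝ 2 (uncurry fun y s => fderiv ℝ (u · s) y v) (x, t) :=
  ((hu.fderiv_right (by norm_num)).clm_apply contDiffAt_const).congr_of_eventuallyEq
    (uncurry_fderiv_eventuallyEq (hu.of_le (by norm_num)) v)

theorem hasFDerivAt_deriv_slice (hu : ContDiffAt ℝ 2 (uncurry u) (x, t)) :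
    HasFDerivAt (fun y => deriv (u y) t)
      (((hessian (uncurry u) (x, t)).flip (0, 1)).comp (ContinuousLinearMap.inl ℝ E ℝ)) x := by
  have hspace : Tendsto (fun y : E => (y, t)) (𝓝 x) (𝓝 (x, t)) :=
    Continuous.tendsto' (by fun_prop) _ _ rfl
  have h := hasFDerivAt_slice
    ((hasFDerivAt_fderiv hu).clm_apply (hasFDerivAt_const ((0 : E), (1 : ℝ)) (x, t)))
  refine (h.congr_fderiv ?_).congr_of_eventuallyEq ?_
  · ext v
    simp
  · filter_upwards [hspace.eventually (eventually_hasFDerivAt hu)] with y hy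
    exact (hasDerivAt_slice hy.differentiableAt).deriv

theorem fderiv_deriv_comm (hu : ContDiffAt ℝ 2 (uncurry u) (x, t)) (v : E) :
    fderiv ℝ (fun y => deriv (u y) t) x v = deriv (fun s => fderiv ℝ (u · s) x v) t := by
  have hw : HasFDerivAt (uncurry fun y s => fderiv ℝ (u · s) y v) _ (x, t) :=
    ((hasFDerivAt_fderiv hu).clm_apply
      (hasFDerivAt_const (v, (0 : ℝ)) (x, t))).congr_of_eventuallyEq
        (uncurry_fderiv_eventuallyEq hu v)
  rw [(hasFDerivAt_deriv_slice hu).fderiv, (hasDerivAt_slice hw.differentiableAt).deriv, hw.fderiv]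
  simpa using hessian_comm hu (v, 0) (0, 1)

end Calculus

section GraphOperator

variable {n : ℕ}

theorem sum_smul_single (p : EuclideanSpace ℝ (Fin n)) :
    ∑ i, p i • EuclideanSpace.single i (1 : ℝ) = p := by
  simpa using (EuclideanSpace.basisFun (Fin n) ℝ).sum_repr p

/-- The trace of the bilinear form `B` with respect to the metric of a graph with gradient `p`:
the contraction of `B` with the inverse metric `δⁱʲ - pⁱ pʲ / (1 + |p|²)`. -/
noncomputable def metricTrace (p : EuclideanSpace ℝ (Fin n))
    (B : EuclideanSpace ℝ (Fin n) →L[ℝ] EuclideanSpace ℝ (Fin n) →L[ℝ] ℝ) : ℝ :=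
  ∑ i, B (EuclideanSpace.single i 1) (EuclideanSpace.single i 1) - B p p / (1 + ‖p‖ ^ 2)

/-- The squared norm of the covector `q` in the inverse metric `δⁱʲ - pⁱ pʲ / (1 + |p|²)` of a graph
with gradient `p`. -/
noncomputable def covectorNormSq (p q : EuclideanSpace ℝ (Fin n)) : ℝ :=
  ‖q‖ ^ 2 - inner ℝ p q ^ 2 / (1 + ‖p‖ ^ 2)

variable {p q : EuclideanSpace ℝ (Fin n)}
  {B B' : EuclideanSpace ℝ (Fin n) →L[ℝ] EuclideanSpace ℝ (Fin n) →L[ℝ] ℝ}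

theorem metricTrace_add : metricTrace p (B + B') = metricTrace p B + metricTrace p B' := by
  simp only [metricTrace, add_apply, Finset.sum_add_distrib]
  ring

theorem metricTrace_smul (c : ℝ) : metricTrace p (c • B) = c * metricTrace p B := by
  simp only [metricTrace, smul_apply, smul_eq_mul, ← Finset.mul_sum]
  ring

theorem metricTrace_innerSL :
    metricTrace p (innerSL ℝ) = n - ‖p‖ ^ 2 / (1 + ‖p‖ ^ 2) := by
  change ∑ i : Fin n, inner ℝ (EuclideanSpace.single i (1 : ℝ)) (EuclideanSpace.single i 1) -
    inner ℝ p p / (1 + ‖p‖ ^ 2) = _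
  simp

theorem metricTrace_smulRight :
    metricTrace p ((innerSL ℝ q).smulRight (innerSL ℝ q)) = covectorNormSq p q := by
  simp [metricTrace, covectorNormSq, EuclideanSpace.norm_sq_eq, real_inner_comm, ← pow_two,
    EuclideanSpace.inner_single_right]

theorem metricTrace_nonpos (hB : ∀ w, B w w ≤ 0) : metricTrace p B ≤ 0 := by
  set c := (1 + ‖p‖ ^ 2)⁻¹ with hc
  let e (i : Fin n) : EuclideanSpace ℝ (Fin n) := EuclideanSpace.single i 1
  have hleft : ∑ i, p i * B (e i) p = B p p := by
    simpa [e] using congrArg (B.flip p) (sum_smul_single p)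
  have hright : ∑ i, p i * B p (e i) = B p p := by
    simpa [e] using congrArg (B p) (sum_smul_single p)
  -- Complete the square: the inverse metric is `∑ᵢ (eᵢ - c pᵢ p)² + c² p²` with `c = 1/(1 + |p|²)`.
  have hsquare : metricTrace p B =
      ∑ i, B (e i - (c * p i) • p) (e i - (c * p i) • p) + c ^ 2 * B p p := by
    have hterm (i : Fin n) : B (e i - (c * p i) • p) (e i - (c * p i) • p) =
        B (e i) (e i) - c * (p i * B (e i) p) - c * (p i * B p (e i)) +
          c ^ 2 * B p p * p i ^ 2 := by
      simp only [map_sub, map_smul, sub_apply, smul_apply, smul_eq_mul]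
      ring
    have hc1 : c * (1 + ‖p‖ ^ 2) = 1 := inv_mul_cancel₀ (by positivity)
    simp only [hterm, Finset.sum_add_distrib, Finset.sum_sub_distrib, ← Finset.mul_sum, hleft,
      hright, ← EuclideanSpace.real_norm_sq_eq, metricTrace, div_eq_mul_inv, ← hc, e]
    linear_combination -(c * B p p) * hc1
  rw [hsquare]
  exact add_nonpos (Finset.sum_nonpos fun i _ => hB _)
    (mul_nonpos_of_nonneg_of_nonpos (sq_nonneg c) (hB p))

theorem div_le_covectorNormSq : ‖q‖ ^ 2 / (1 + ‖p‖ ^ 2) ≤ covectorNormSq p q := by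
  have hcs : inner ℝ p q ^ 2 ≤ ‖p‖ ^ 2 * ‖q‖ ^ 2 := by
    simpa [← pow_two] using real_inner_mul_inner_self_le p q
  rw [covectorNormSq, le_sub_iff_add_le, ← add_div, div_le_iff₀ (by positivity)]
  linarith

theorem hasDerivAt_metricTrace {g : ℝ → EuclideanSpace ℝ (Fin n)} {s : ℝ}
    {H : ℝ → EuclideanSpace ℝ (Fin n) →L[ℝ] EuclideanSpace ℝ (Fin n) →L[ℝ] ℝ}
    (hg : HasDerivAt g q s) (hH : HasDerivAt H B s) :
    HasDerivAt (fun a => metricTrace (g a) (H a))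
      (metricTrace (g s) B - (H s q (g s) + H s (g s) q) / (1 + ‖g s‖ ^ 2) +
        2 * inner ℝ (g s) q * H s (g s) (g s) / (1 + ‖g s‖ ^ 2) ^ 2) s := by
  have htrace : HasDerivAt (fun a => ∑ i : Fin n,
      H a (EuclideanSpace.single i 1) (EuclideanSpace.single i 1))
      (∑ i, B (EuclideanSpace.single i 1) (EuclideanSpace.single i 1)) s :=
    HasDerivAt.fun_sum fun i _ => by
      simpa using (hH.clm_apply (hasDerivAt_const s (EuclideanSpace.single i (1 : ℝ)))).clm_apply
        (hasDerivAt_const s (EuclideanSpace.single i (1 : ℝ)))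
  have hnormal : HasDerivAt (fun a => H a (g a) (g a))
      (B (g s) (g s) + H s q (g s) + H s (g s) q) s := by
    simpa using (hH.clm_apply hg).clm_apply hg
  have hnorm : HasDerivAt (fun a => 1 + ‖g a‖ ^ 2) (2 * inner ℝ (g s) q) s :=
    hg.norm_sq.const_add 1
  refine (htrace.sub (hnormal.div hnorm (by positivity))).congr_deriv ?_
  rw [metricTrace]
  field_simp
  ring

/-- The heat operator `∂ₜ - (δⁱʲ - pⁱ pʲ / (1 + |p|²)) ∂ᵢ ∂ⱼ` of a graph, with its coefficients
frozen at the gradient `p`, applied to `f` at `(x, t)`. -/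
noncomputable def graphHeat (p : EuclideanSpace ℝ (Fin n)) (f : EuclideanSpace ℝ (Fin n) → ℝ → ℝ)
    (x : EuclideanSpace ℝ (Fin n)) (t : ℝ) : ℝ :=
  deriv (f x) t - metricTrace p (hessian (f · t) x)

variable {f g : EuclideanSpace ℝ (Fin n) → ℝ → ℝ} {x : EuclideanSpace ℝ (Fin n)} {t : ℝ}

theorem graphHeat_add_const_mul (hf : ContDiffAt ℝ 2 (uncurry f) (x, t))
    (hg : ContDiffAt ℝ 2 (uncurry g) (x, t)) (c : ℝ) :
    graphHeat p (fun y s => f y s + c * g y s) x t = graphHeat p f x t + c * graphHeat p g x t := by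
  have hft := (hasDerivAt_slice (hf.differentiableAt two_ne_zero)).differentiableAt.hasDerivAt
  have hgt := (hasDerivAt_slice (hg.differentiableAt two_ne_zero)).differentiableAt.hasDerivAt
  rw [graphHeat, hessian_add_const_mul (contDiffAt_slice hf) (contDiffAt_slice hg),
    metricTrace_add, metricTrace_smul, (hft.fun_add (hgt.const_mul c)).deriv, graphHeat, graphHeat]
  ring

theorem graphHeat_comp {ψ ψ' : ℝ → ℝ} {ψ'' : ℝ} (hψ : ∀ᶠ s in 𝓝 (f x t), HasDerivAt ψ (ψ' s) s)
    (hψ' : HasDerivAt ψ' ψ'' (f x t)) (hf : ContDiffAt ℝ 2 (uncurry f) (x, t)) :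
    graphHeat p (fun y s => ψ (f y s)) x t =
      ψ' (f x t) * graphHeat p f x t - ψ'' * covectorNormSq p (∇ (f · t) x) := by
  have hft := (hasDerivAt_slice (hf.differentiableAt two_ne_zero)).differentiableAt.hasDerivAt
  have hgrad : fderiv ℝ (f · t) x = innerSL ℝ (∇ (f · t) x) :=
    ((InnerProductSpace.toDual ℝ _).apply_symm_apply _).symm
  have htime : HasDerivAt (fun s => ψ (f x s)) (ψ' (f x t) * deriv (f x) t) t :=
    hψ.self_of_nhds.comp t hft
  rw [graphHeat, hessian_comp (f := (f · t)) hψ hψ' (contDiffAt_slice hf),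
    metricTrace_add, metricTrace_smul, metricTrace_smul, hgrad, metricTrace_smulRight,
    htime.deriv, graphHeat]
  ring

theorem graphHeat_nonneg_of_isLocalMaxOn (hf : ContDiffAt ℝ 2 (uncurry f) (x, t))
    (hmax : IsLocalMaxOn (uncurry f) (univ ×ˢ Iic t) (x, t)) : 0 ≤ graphHeat p f x t := by
  have hspace : IsLocalMax (f · t) x := by
    have h : Tendsto (fun y : EuclideanSpace ℝ (Fin n) => (y, t)) (𝓝 x)
        (𝓝[univ ×ˢ Iic t] (x, t)) :=
      tendsto_nhdsWithin_iff.2 ⟨Continuous.tendsto' (by fun_prop) _ _ rfl, by simp⟩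
    exact h.eventually hmax
  have htime : IsLocalMaxOn (f x) (Iic t) t := by
    have h : Tendsto (fun s : ℝ => (x, s)) (𝓝[≤] t) (𝓝[univ ×ˢ Iic t] (x, t)) :=
      tendsto_nhdsWithin_iff.2 ⟨(Continuous.tendsto' (by fun_prop) _ _ rfl).mono_left
        nhdsWithin_le_nhds, by simpa using! self_mem_nhdsWithin⟩
    exact h.eventually hmax
  have hderiv : 0 ≤ deriv (f x) t := by
    have hft := (hasDerivAt_slice (hf.differentiableAt two_ne_zero)).differentiableAt.hasDerivAt
    have h := htime.hasFDerivWithinAt_nonpos hft.hasFDerivAt.hasFDerivWithinAt (y := -1)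
      (mem_posTangentConeAt_of_segment_subset (by
        rw [segment_eq_uIcc, uIcc_of_ge (by linarith)]; exact Icc_subset_Iic_self))
    simpa using h
  exact sub_nonneg.2 ((metricTrace_nonpos
    (hessian_nonpos_of_isLocalMax (contDiffAt_slice hf) hspace)).trans hderiv)

end GraphOperator

section MeanCurvatureFlow

variable {n : ℕ} {f : EuclideanSpace ℝ (Fin n) → ℝ} {x : EuclideanSpace ℝ (Fin n)}

theorem differentiableAt_gradient (hf : ContDiffAt ℝ 2 f x) : DifferentiableAt ℝ (∇ f) x := by
  rw [differentiableAt_euclidean]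
  intro i
  have hi : (fun y => ∇ f y i) = fun y => fderiv ℝ f y (EuclideanSpace.single i 1) := by
    ext y
    rw [← inner_gradient_left, EuclideanSpace.inner_single_right]
    simp
  rw [hi]
  exact (hasFDerivAt_fderiv hf).differentiableAt.clm_apply (differentiableAt_const _)

theorem inner_fderiv_gradient (hf : ContDiffAt ℝ 2 f x) (v w : EuclideanSpace ℝ (Fin n)) :
    inner ℝ (fderiv ℝ (∇ f) x v) w = hessian f x v w := by
  have h := (differentiableAt_gradient hf).hasFDerivAt.inner ℝ (hasFDerivAt_const w x)
  simp only [inner_gradient_left] at h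
  rw [← fderiv_fderiv_apply hf, h.fderiv]
  simp

theorem one_le_volumeElement (f : EuclideanSpace ℝ (Fin n) → ℝ) (x : EuclideanSpace ℝ (Fin n)) :
    1 ≤ volumeElement f x :=
  Real.one_le_sqrt.2 (le_add_of_nonneg_right (sq_nonneg _))

theorem hasFDerivAt_volumeElement (hf : ContDiffAt ℝ 2 f x) :
    HasFDerivAt (volumeElement f) ((volumeElement f x)⁻¹ • (hessian f x).flip (∇ f x)) x := by
  have hnorm := (differentiableAt_gradient hf).hasFDerivAt.norm_sq.const_add 1
  refine (hnorm.sqrt (by positivity)).congr_fderiv ?_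
  ext v
  simp only [volumeElement, ← inner_fderiv_gradient hf, real_inner_comm (∇ f x), smul_apply,
    ContinuousLinearMap.comp_apply, innerSL_apply_apply, ContinuousLinearMap.flip_apply,
    smul_eq_mul, nsmul_eq_mul, Nat.cast_ofNat]
  ring

theorem volumeElement_mul_euclideanDiv (hf : ContDiffAt ℝ 2 f x) :
    volumeElement f x * euclideanDiv (fun z => (volumeElement f z)⁻¹ • ∇ f z) x =
      metricTrace (∇ f x) (hessian f x) := by
  have hv : volumeElement f x ≠ 0 := (one_pos.trans_le (one_le_volumeElement f x)).ne'
  have hv2 : volumeElement f x ^ 2 = 1 + ‖∇ f x‖ ^ 2 := Real.sq_sqrt (by positivity)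
  have hinv : HasFDerivAt (fun z => (volumeElement f z)⁻¹) _ x :=
    (hasDerivAt_inv hv).comp_hasFDerivAt x (hasFDerivAt_volumeElement hf)
  have hterm (i : Fin n) : fderiv ℝ (fun z => (volumeElement f z)⁻¹ • ∇ f z) x
      (EuclideanSpace.single i 1) i =
      (volumeElement f x)⁻¹ * hessian f x (EuclideanSpace.single i 1) (EuclideanSpace.single i 1) -
        (volumeElement f x)⁻¹ ^ 3 *
          (∇ f x i * hessian f x (EuclideanSpace.single i 1) (∇ f x)) := by
    rw [(hinv.fun_smul (differentiableAt_gradient hf).hasFDerivAt).fderiv,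
      ← inner_fderiv_gradient hf _ (EuclideanSpace.single i 1), EuclideanSpace.inner_single_right]
    simp
    ring
  have hnormal : ∑ i, ∇ f x i * hessian f x (EuclideanSpace.single i 1) (∇ f x) =
      hessian f x (∇ f x) (∇ f x) := by
    simpa using congrArg ((hessian f x).flip (∇ f x)) (sum_smul_single (∇ f x))
  simp only [euclideanDiv, hterm, Finset.sum_sub_distrib, ← Finset.mul_sum, hnormal, metricTrace,
    ← hv2]
  field_simp

variable {r t : ℝ} {p : EuclideanSpace ℝ (Fin n)} {u : EuclideanSpace ℝ (Fin n) → ℝ → ℝ}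

theorem GraphFlowsByMeanCurvature.contDiffAt (hu : GraphFlowsByMeanCurvature r u) (k : ℕ)
    (hx : x ∈ Metric.ball 0 r) (ht : t ∈ Ioo 0 (r ^ 2)) : ContDiffAt ℝ k (uncurry u) (x, t) := by
  have hcyl : Metric.ball 0 r ×ˢ Ioo 0 (r ^ 2) ∈ 𝓝 (x, t) :=
    (Metric.isOpen_ball.prod isOpen_Ioo).mem_nhds ⟨hx, ht⟩
  exact (hu.contDiffOn.contDiffAt hcyl).of_le (WithTop.coe_le_coe.2 le_top)

theorem GraphFlowsByMeanCurvature.graphHeat_self (hu : GraphFlowsByMeanCurvature r u)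
    (hx : x ∈ Metric.ball 0 r) (ht : t ∈ Ioo 0 (r ^ 2)) : graphHeat (∇ (u · t) x) u x t = 0 := by
  rw [graphHeat, ← volumeElement_mul_euclideanDiv (contDiffAt_slice (hu.contDiffAt 2 hx ht)),
    sub_eq_zero]
  exact hu.equation x hx t ht

theorem hasDerivAt_metricTrace_line (hf : ContDiffAt ℝ 3 f x) (hp : ∇ f x = p) :
    HasDerivAt (fun s : ℝ => metricTrace (∇ f (x + s • p)) (hessian f (x + s • p)))
      (metricTrace p (hessian (fun y => fderiv ℝ f y p) x) -
        2 / (1 + ‖p‖ ^ 2) * covectorNormSq p (∇ (fun y => fderiv ℝ f y p) x)) 0 := by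
  have hf2 : ContDiffAt ℝ 2 f x := hf.of_le (by norm_num)
  obtain ⟨q, hq⟩ : ∃ q, ∇ (fun y => fderiv ℝ f y p) x = q := ⟨_, rfl⟩
  have hqp (v : EuclideanSpace ℝ (Fin n)) : hessian f x v p = inner ℝ q v := by
    rw [← hq, inner_gradient_left, fderiv_fderiv_apply hf2]
  have hgrad : fderiv ℝ (∇ f) x p = q := ext_inner_right ℝ fun v => by
    rw [inner_fderiv_gradient hf2, hessian_comm hf2, hqp]
  have hgradLine : HasLineDerivAt ℝ (∇ f) (fderiv ℝ (∇ f) x p) x p :=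
    (differentiableAt_gradient hf2).hasFDerivAt.hasLineDerivAt p
  have hhessLine : HasLineDerivAt ℝ (hessian f) (fderiv ℝ (hessian f) x p) x p :=
    (differentiableAt_hessian hf).hasFDerivAt.hasLineDerivAt p
  refine (hasDerivAt_metricTrace hgradLine hhessLine).congr_deriv ?_
  simp only [zero_smul, add_zero, hp, hgrad, hqp, hessian_fderiv_apply hf, hessian_comm hf2 p q,
    covectorNormSq, real_inner_self_eq_norm_sq, real_inner_comm, hq]
  field_simp
  ring

theorem graphHeat_fderiv_gradient (hu : ContDiffAt ℝ 3 (uncurry u) (x, t))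
    (heq : ∀ᶠ y in 𝓝 x, graphHeat (∇ (u · t) y) u y t = 0) (hp : ∇ (u · t) x = p) :
    graphHeat p (fun y s => fderiv ℝ (u · s) y p) x t =
      -(2 / (1 + ‖p‖ ^ 2) * covectorNormSq p (∇ (fun y => fderiv ℝ (u · t) y p) x)) := by
  have hu2 : ContDiffAt ℝ 2 (uncurry u) (x, t) := hu.of_le (by norm_num)
  have htime : HasDerivAt (fun s : ℝ => deriv (u (x + s • p)) t)
      (deriv (fun s => fderiv ℝ (u · s) x p) t) 0 := by
    rw [← fderiv_deriv_comm hu2]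
    exact (hasFDerivAt_deriv_slice hu2).differentiableAt.hasFDerivAt.hasLineDerivAt p
  have hev : (fun s : ℝ => deriv (u (x + s • p)) t) =ᶠ[𝓝 0] fun s =>
      metricTrace (∇ (u · t) (x + s • p)) (hessian (u · t) (x + s • p)) := by
    have htendsto : Tendsto (fun s : ℝ => x + s • p) (𝓝 0) (𝓝 x) :=
      Continuous.tendsto' (by fun_prop) _ _ (by simp)
    exact htendsto.eventually (heq.mono fun _ hy => sub_eq_zero.1 hy)
  rw [graphHeat, htime.unique
    ((hasDerivAt_metricTrace_line (contDiffAt_slice hu) hp).congr_of_eventuallyEq hev)]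
  ring

theorem graphHeat_inv_one_add_fderiv_gradient (hu : ContDiffAt ℝ 3 (uncurry u) (x, t))
    (heq : ∀ᶠ y in 𝓝 x, graphHeat (∇ (u · t) y) u y t = 0) (hp : ∇ (u · t) x = p) :
    graphHeat p (fun y s => (1 + fderiv ℝ (u · s) y p)⁻¹) x t = 0 := by
  have hw : fderiv ℝ (u · t) x p = ‖p‖ ^ 2 := by
    rw [← inner_gradient_left, hp, real_inner_self_eq_norm_sq]
  have hψ : ∀ᶠ s in 𝓝 (fderiv ℝ (u · t) x p),
      HasDerivAt (fun s => (1 + s)⁻¹) (-((1 + s) ^ 2)⁻¹) s := by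
    have hpos : 0 < 1 + fderiv ℝ (u · t) x p := by rw [hw]; positivity
    filter_upwards
      [(continuousAt_const.add continuousAt_id).eventually (lt_mem_nhds hpos)] with s hs
    exact HasDerivAt.comp_const_add 1 s (hasDerivAt_inv (ne_of_gt hs))
  have hψ' : HasDerivAt (fun s : ℝ => -((1 + s) ^ 2)⁻¹) (2 / (1 + ‖p‖ ^ 2) ^ 3)
      (fderiv ℝ (u · t) x p) := by
    rw [hw]
    have hpos : (1 + id (‖p‖ ^ 2)) ^ 2 ≠ 0 := by simp only [id]; positivity
    refine ((((hasDerivAt_id _).const_add 1).fun_pow 2).fun_inv hpos).fun_neg.congr_deriv ?_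
    simp only [id, Nat.cast_ofNat, Nat.add_one_sub_one, pow_one]
    field_simp
  rw [graphHeat_comp hψ hψ' (contDiffAt_uncurry_fderiv hu p), graphHeat_fderiv_gradient hu heq hp,
    hw]
  field_simp
  ring

theorem one_add_fderiv_le (f : EuclideanSpace ℝ (Fin n) → ℝ) (x p : EuclideanSpace ℝ (Fin n)) :
    1 + fderiv ℝ f x p ≤ √(1 + ‖p‖ ^ 2) * volumeElement f x := by
  rw [volumeElement, ← Real.sqrt_mul (by positivity), ← inner_gradient_left]
  refine Real.le_sqrt_of_sq_le ?_
  have hcs : inner ℝ (∇ f x) p ^ 2 ≤ ‖∇ f x‖ ^ 2 * ‖p‖ ^ 2 := by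
    simpa [← pow_two] using real_inner_mul_inner_self_le (∇ f x) p
  have hsub : 0 ≤ ‖∇ f x - p‖ ^ 2 := sq_nonneg _
  rw [norm_sub_sq_real] at hsub
  linarith

theorem isLocalMaxOn_add_neg_mul_inv {X : Type*} [TopologicalSpace X] {S : Set X} {z : X}
    {η m v : X → ℝ} {c : ℝ} (hc : 0 ≤ c) (hle : ∀ y, m y ≤ c * v y) (hz : m z = c * v z)
    (hm : ContinuousAt m z) (hm_pos : 0 < m z) (hη_pos : 0 < η z)
    (hmax : IsLocalMaxOn (fun y => η y * v y) S z) :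
    IsLocalMaxOn (fun y => η y + -(η z * m z) * (m y)⁻¹) S z := by
  filter_upwards [hmax, nhdsWithin_le_nhds (hm.eventually (lt_mem_nhds hm_pos))] with y hy hmy
  have hprod : η y * m y ≤ η z * m z := by
    rcases le_total (η y) 0 with hneg | hnonneg
    · exact (mul_nonpos_of_nonpos_of_nonneg hneg hmy.le).trans (mul_pos hη_pos hm_pos).le
    calc η y * m y ≤ η y * (c * v y) := mul_le_mul_of_nonneg_left (hle y) hnonneg
      _ = c * (η y * v y) := by ring
      _ ≤ c * (η z * v z) := mul_le_mul_of_nonneg_left hy hc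
      _ = η z * m z := by rw [hz]; ring
  have hdiv := (le_div_iff₀ hmy).2 hprod
  rw [neg_mul, neg_mul, mul_inv_cancel_right₀ hm_pos.ne', ← div_eq_mul_inv]
  linarith

theorem graphHeat_nonneg_of_isLocalMaxOn_mul_volumeElement
    {η : EuclideanSpace ℝ (Fin n) → ℝ → ℝ} (hu : ContDiffAt ℝ 3 (uncurry u) (x, t))
    (heq : ∀ᶠ y in 𝓝 x, graphHeat (∇ (u · t) y) u y t = 0) (hp : ∇ (u · t) x = p)
    (hη : ContDiffAt ℝ 2 (uncurry η) (x, t)) (hpos : 0 < η x t)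
    (hmax : IsLocalMaxOn (uncurry fun y s => η y s * volumeElement (u · s) y)
      (univ ×ˢ Iic t) (x, t)) :
    0 ≤ graphHeat p η x t := by
  let m : EuclideanSpace ℝ (Fin n) → ℝ → ℝ := fun y s => 1 + fderiv ℝ (u · s) y p
  have hmx : m x t = 1 + ‖p‖ ^ 2 := by
    simp only [m, ← inner_gradient_left, hp, real_inner_self_eq_norm_sq]
  have hmx_pos : 0 < m x t := by rw [hmx]; positivity
  have hm : ContDiffAt ℝ 2 (uncurry m) (x, t) :=
    contDiffAt_const.add (contDiffAt_uncurry_fderiv hu p)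
  have hm_inv : ContDiffAt ℝ 2 (uncurry fun y s => (m y s)⁻¹) (x, t) := hm.inv hmx_pos.ne'
  have htangent : m x t = √(1 + ‖p‖ ^ 2) * volumeElement (u · t) x := by
    rw [hmx, volumeElement, hp, Real.mul_self_sqrt (by positivity)]
  have htouch : IsLocalMaxOn (uncurry fun y s => η y s + -(η x t * m x t) * (m y s)⁻¹)
      (univ ×ˢ Iic t) (x, t) :=
    isLocalMaxOn_add_neg_mul_inv (η := uncurry η) (m := uncurry m)
      (v := uncurry fun y s => volumeElement (u · s) y) (Real.sqrt_nonneg _)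
      (fun z => one_add_fderiv_le (u · z.2) z.1 p) htangent hm.continuousAt hmx_pos hpos hmax
  have hheat := graphHeat_nonneg_of_isLocalMaxOn (p := p)
    (hη.add (contDiffAt_const.mul hm_inv)) htouch
  rwa [graphHeat_add_const_mul hη hm_inv, graphHeat_inv_one_add_fderiv_gradient hu heq hp, mul_zero,
    add_zero] at hheat

end MeanCurvatureFlow

section Barrier

variable {n : ℕ} {c r α β K t : ℝ} {x p : EuclideanSpace ℝ (Fin n)}
  {u : EuclideanSpace ℝ (Fin n) → ℝ → ℝ}

/-- A paraboloid that rises with time from `-β`, its value on the lateral boundary and at the bottom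
of `B_r × [0, ∞)`. -/
noncomputable def barrier (c r β : ℝ) (x : EuclideanSpace ℝ (Fin n)) (t : ℝ) : ℝ :=
  c * t * (r ^ 2 - ‖x‖ ^ 2) - β

theorem contDiff_barrier {k : ℕ∞ω} :
    ContDiff ℝ k (uncurry (barrier (n := n) c r β)) :=
  ((contDiff_const.mul contDiff_snd).mul
    (contDiff_const.sub (contDiff_fst.norm_sq ℝ))).sub contDiff_const

theorem hasFDerivAt_barrier (c r β : ℝ) (x : EuclideanSpace ℝ (Fin n)) (t : ℝ) :
    HasFDerivAt (barrier c r β · t) (-(2 * c * t) • innerSL ℝ x) x := by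
  have h := (((hasStrictFDerivAt_norm_sq x).hasFDerivAt.const_sub (r ^ 2)).const_mul
    (c * t)).sub_const β
  refine h.congr_fderiv ?_
  ext v
  simp
  ring

theorem hessian_barrier : hessian (barrier c r β · t) x = -(2 * c * t) • innerSL ℝ :=
  hessian_eq_of_eventually_hasFDerivAt
    (Eventually.of_forall fun y => hasFDerivAt_barrier c r β y t)
    ((innerSL ℝ).hasFDerivAt.const_smul (-(2 * c * t)))

theorem graphHeat_barrier_le (hc : 0 ≤ c) (ht : 0 ≤ t) :
    graphHeat p (barrier c r β) x t ≤ c * (r ^ 2 + 2 * n * t) := by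
  have htime : HasDerivAt (barrier c r β x) (c * (r ^ 2 - ‖x‖ ^ 2)) t := by
    have h := (((hasDerivAt_id t).const_mul c).mul_const (r ^ 2 - ‖x‖ ^ 2)).sub_const β
    exact h.congr_deriv (by rw [mul_one])
  rw [graphHeat, htime.deriv, hessian_barrier, metricTrace_smul, metricTrace_innerSL]
  have hx : 0 ≤ c * ‖x‖ ^ 2 := by positivity
  have hp : 0 ≤ 2 * c * t * (‖p‖ ^ 2 / (1 + ‖p‖ ^ 2)) := by positivity
  linarith

/-- The height `α u` of the graph tilted by the barrier. If `|α u| < β`, it can be positive only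
away from the parabolic boundary. -/
noncomputable def tiltedHeight (c r β α : ℝ) (u : EuclideanSpace ℝ (Fin n) → ℝ → ℝ)
    (x : EuclideanSpace ℝ (Fin n)) (t : ℝ) : ℝ :=
  barrier c r β x t + α * u x t

/-- The volume element of the graph of `u`, cut off where the tilted height is not positive. -/
noncomputable def cutoffVolume (K c r β α : ℝ) (u : EuclideanSpace ℝ (Fin n) → ℝ → ℝ)
    (x : EuclideanSpace ℝ (Fin n)) (t : ℝ) : ℝ :=
  (Real.exp (K * tiltedHeight c r β α u x t) - 1) * volumeElement (u · t) x

theorem gradient_tiltedHeight (hu : DifferentiableAt ℝ (u · t) x) :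
    ∇ (tiltedHeight c r β α u · t) x = α • ∇ (u · t) x - (2 * c * t) • x := by
  refine ext_inner_right ℝ fun v => ?_
  have h := (hasFDerivAt_barrier c r β x t).fun_add (hu.hasFDerivAt.const_mul α)
  rw [inner_gradient_left, show fderiv ℝ (tiltedHeight c r β α u · t) x = _ from h.fderiv,
    inner_sub_left, inner_smul_left, inner_smul_left, inner_gradient_left]
  simp
  ring

theorem graphHeat_exp_mul_sub_one {φ : EuclideanSpace ℝ (Fin n) → ℝ → ℝ}
    (hφ : ContDiffAt ℝ 2 (uncurry φ) (x, t)) :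
    graphHeat p (fun y s => Real.exp (K * φ y s) - 1) x t =
      K * Real.exp (K * φ x t) *
        (graphHeat p φ x t - K * covectorNormSq p (∇ (φ · t) x)) := by
  have hexp (a s : ℝ) :
      HasDerivAt (fun s => a * Real.exp (K * s)) (a * K * Real.exp (K * s)) s := by
    refine (((hasDerivAt_id s).const_mul K).exp.const_mul a).congr_deriv ?_
    simp only [id]
    ring
  have hψ (s : ℝ) : HasDerivAt (fun s => Real.exp (K * s) - 1) (K * Real.exp (K * s)) s := by
    simpa using (hexp 1 s).sub_const 1
  rw [graphHeat_comp (Eventually.of_forall hψ) (hexp K _) hφ]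
  ring

theorem norm_sq_div_le_of_isLocalMaxOn (hc : 0 ≤ c) (ht : 0 ≤ t) (hK : 0 < K)
    (hu : ContDiffAt ℝ 3 (uncurry u) (x, t))
    (heq : ∀ᶠ y in 𝓝 x, graphHeat (∇ (u · t) y) u y t = 0) (hp : ∇ (u · t) x = p)
    (hpos : 0 < tiltedHeight c r β α u x t)
    (hmax : IsLocalMaxOn (uncurry (cutoffVolume K c r β α u)) (univ ×ˢ Iic t) (x, t)) :
    K * (‖α • p - (2 * c * t) • x‖ ^ 2 / (1 + ‖p‖ ^ 2)) ≤ c * (r ^ 2 + 2 * n * t) := by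
  have hu2 : ContDiffAt ℝ 2 (uncurry u) (x, t) := hu.of_le (by norm_num)
  have hb : ContDiffAt ℝ 2 (uncurry (barrier c r β)) (x, t) := contDiff_barrier.contDiffAt
  have hφ : ContDiffAt ℝ 2 (uncurry (tiltedHeight c r β α u)) (x, t) :=
    hb.add (contDiffAt_const.mul hu2)
  have hη : ContDiffAt ℝ 2
      (uncurry fun y s => Real.exp (K * tiltedHeight c r β α u y s) - 1) (x, t) :=
    (contDiffAt_const.mul hφ).exp.sub contDiffAt_const
  have hη_pos : 0 < Real.exp (K * tiltedHeight c r β α u x t) - 1 :=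
    sub_pos.2 (Real.one_lt_exp_iff.2 (mul_pos hK hpos))
  have hheat := graphHeat_nonneg_of_isLocalMaxOn_mul_volumeElement hu heq hp hη hη_pos hmax
  rw [graphHeat_exp_mul_sub_one hφ, gradient_tiltedHeight
    ((contDiffAt_slice hu2).differentiableAt two_ne_zero), hp] at hheat
  have hφ_heat : graphHeat p (tiltedHeight c r β α u) x t = graphHeat p (barrier c r β) x t := by
    have hself : graphHeat p u x t = 0 := hp ▸ heq.self_of_nhds
    have h := graphHeat_add_const_mul (p := p) hb hu2 α
    rwa [hself, mul_zero, add_zero] at h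
  calc K * (‖α • p - (2 * c * t) • x‖ ^ 2 / (1 + ‖p‖ ^ 2))
      ≤ K * covectorNormSq p (α • p - (2 * c * t) • x) :=
        mul_le_mul_of_nonneg_left div_le_covectorNormSq hK.le
    _ ≤ graphHeat p (barrier c r β) x t := by
        rw [← hφ_heat]
        exact sub_nonneg.1 (nonneg_of_mul_nonneg_right hheat (by positivity))
    _ ≤ c * (r ^ 2 + 2 * n * t) := graphHeat_barrier_le hc ht

end Barrier

section Estimate

theorem continuousAt_volumeElement {n : ℕ} {u : EuclideanSpace ℝ (Fin n) → ℝ → ℝ}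
    {x : EuclideanSpace ℝ (Fin n)} {t : ℝ} (hu : ContDiffAt ℝ 2 (uncurry u) (x, t)) :
    ContinuousAt (uncurry fun y s => volumeElement (u · s) y) (x, t) := by
  let inl := ContinuousLinearMap.inl ℝ (EuclideanSpace ℝ (Fin n)) ℝ
  have hnorm (f : EuclideanSpace ℝ (Fin n) → ℝ) (y) : ‖∇ f y‖ = ‖fderiv ℝ f y‖ :=
    (InnerProductSpace.toDual ℝ _).symm.norm_map _
  have hev : (uncurry fun y s => volumeElement (u · s) y) =ᶠ[𝓝 (x, t)]
      fun q => √(1 + ‖(fderiv ℝ (uncurry u) q).comp inl‖ ^ 2) := by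
    filter_upwards [eventually_hasFDerivAt hu] with q hq
    have hslice : HasFDerivAt (u · q.2) _ q.1 := hasFDerivAt_slice hq
    change √(1 + ‖∇ (u · q.2) q.1‖ ^ 2) = _
    rw [hnorm, hslice.fderiv]
  have hfderiv : ContinuousAt (fderiv ℝ (uncurry u)) (x, t) :=
    (hasFDerivAt_fderiv hu).continuousAt
  exact (continuousAt_const.add
    ((hfderiv.clm_comp continuousAt_const).norm.pow 2)).sqrt.congr_of_eventuallyEq hev

theorem exists_isLocalMaxOn_of_pos {X : Type*} [PseudoMetricSpace X] [ProperSpace X] {a : X}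
    {r T T' : ℝ} (hT : T < T') {F χ : X × ℝ → ℝ}
    (hF : ContinuousOn F (Metric.ball a r ×ˢ Ioo 0 T')) (hχ : Continuous χ)
    (hχ_side : ∀ x t, dist x a = r → χ (x, t) < 0) (hχ_bottom : ∀ x, χ (x, 0) < 0)
    (hFχ : ∀ q ∈ Metric.ball a r ×ˢ Ioc 0 T, 0 < F q → 0 < χ q) {q₀ : X × ℝ}
    (hq₀ : q₀ ∈ Metric.ball a r ×ˢ Ioc 0 T) (hFq₀ : 0 < F q₀) :
    ∃ q ∈ Metric.ball a r ×ˢ Ioc 0 T,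
      F q₀ ≤ F q ∧ IsLocalMaxOn F (univ ×ˢ Iic q.2) q := by
  let C : Set (X × ℝ) := (Metric.closedBall a r ×ˢ Icc 0 T) ∩ {q | 0 ≤ χ q}
  have hC : IsCompact C :=
    ((isCompact_closedBall a r).prod isCompact_Icc).inter_right
      (isClosed_le continuous_const hχ)
  have hCsub : C ⊆ Metric.ball a r ×ˢ Ioc 0 T := by
    rintro ⟨x, t⟩ ⟨⟨hx, ht⟩, hq⟩
    have hx_ne : dist x a ≠ r := fun h => (hχ_side x t h).not_ge hq
    have ht_ne : 0 ≠ t := by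
      rintro rfl
      exact (hχ_bottom x).not_ge hq
    exact ⟨lt_of_le_of_ne hx hx_ne, lt_of_le_of_ne ht.1 ht_ne, ht.2⟩
  have hmemC {q} (hq : q ∈ Metric.ball a r ×ˢ Ioc 0 T) (hχq : 0 < χ q) : q ∈ C :=
    ⟨⟨Metric.ball_subset_closedBall hq.1, Ioc_subset_Icc_self hq.2⟩, hχq.le⟩
  obtain ⟨q, hqC, hmax⟩ := hC.exists_isMaxOn ⟨q₀, hmemC hq₀ (hFχ q₀ hq₀ hFq₀)⟩
    (hF.mono fun q hq => ⟨(hCsub hq).1, (hCsub hq).2.1, (hCsub hq).2.2.trans_lt hT⟩)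
  have hq := hCsub hqC
  have hle : F q₀ ≤ F q := hmax (hmemC hq₀ (hFχ q₀ hq₀ hFq₀))
  refine ⟨q, hq, hle, eventually_nhdsWithin_iff.2 ?_⟩
  filter_upwards [hχ.continuousAt.eventually_const_lt (hFχ q hq (hFq₀.trans_le hle)),
    (Metric.isOpen_ball.preimage continuous_fst).mem_nhds hq.1,
    (isOpen_Ioi.preimage continuous_snd).mem_nhds hq.2.1] with y hχy hy_ball hy_pos hy_le
  exact hmax (hmemC ⟨hy_ball, hy_pos, hy_le.2.trans hq.2.2⟩ hχy)

variable {n : ℕ} {r c K α β ε D t : ℝ} {x : EuclideanSpace ℝ (Fin n)}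
  {u : EuclideanSpace ℝ (Fin n) → ℝ → ℝ}

theorem tiltedHeight_le_barrier (h : |α * u x t| ≤ β - ε) :
    tiltedHeight c r β α u x t ≤ barrier c r ε x t := by
  simp only [tiltedHeight, barrier]
  linarith [le_of_abs_le h]

theorem barrier_le_tiltedHeight (h : |α * u x t| ≤ β - ε) :
    barrier c r (2 * β - ε) x t ≤ tiltedHeight c r β α u x t := by
  simp only [tiltedHeight, barrier]
  linarith [neg_le_of_abs_le h]

theorem cutoffVolume_pos_iff (hK : 0 < K) :
    0 < cutoffVolume K c r β α u x t ↔ 0 < tiltedHeight c r β α u x t := by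
  rw [cutoffVolume, mul_pos_iff_of_pos_right (one_pos.trans_le (one_le_volumeElement _ _)), sub_pos,
    Real.one_lt_exp_iff, mul_pos_iff_of_pos_left hK]

theorem continuousAt_cutoffVolume (hu : ContDiffAt ℝ 2 (uncurry u) (x, t)) :
    ContinuousAt (uncurry (cutoffVolume K c r β α u)) (x, t) := by
  have hφ : ContinuousAt (uncurry (tiltedHeight c r β α u)) (x, t) :=
    (contDiff_barrier (k := 0)).continuous.continuousAt.add (hu.continuousAt.const_mul α)
  exact ((hφ.const_mul K).rexp.sub_const 1).mul (continuousAt_volumeElement hu)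

theorem exists_isLocalMaxOn_cutoffVolume {T : ℝ} (hr : 0 < r) (hT : T ∈ Ioo 0 (r ^ 2))
    (hK : 0 < K) (hε : 0 < ε) (hu : GraphFlowsByMeanCurvature r u)
    (hα : ∀ x ∈ Metric.ball 0 r, ∀ t ∈ Icc 0 (r ^ 2), |α * u x t| ≤ β - ε)
    (hpos : 0 < tiltedHeight c r β α u 0 T) :
    ∃ x ∈ Metric.ball 0 r, ∃ t ∈ Ioc 0 T, 0 < tiltedHeight c r β α u x t ∧
      cutoffVolume K c r β α u 0 T ≤ cutoffVolume K c r β α u x t ∧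
      IsLocalMaxOn (uncurry (cutoffVolume K c r β α u)) (univ ×ˢ Iic t) (x, t) := by
  have hF_pos := (cutoffVolume_pos_iff hK).2 hpos
  obtain ⟨⟨x, t⟩, hxt, hle, hmax⟩ := exists_isLocalMaxOn_of_pos (a := 0) (q₀ := (0, T)) hT.2
    (F := uncurry (cutoffVolume K c r β α u)) (χ := uncurry (barrier c r ε))
    (fun q hq => (continuousAt_cutoffVolume (hu.contDiffAt 2 hq.1 hq.2)).continuousWithinAt)
    (contDiff_barrier (k := 0)).continuous
    (fun x t hx => by
      rw [dist_zero_right] at hx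
      simpa [barrier, hx] using hε)
    (fun x => by simpa [barrier] using hε)
    (fun q hq hFq => ((cutoffVolume_pos_iff hK).1 hFq).trans_le <| tiltedHeight_le_barrier <|
      hα q.1 hq.1 q.2 ⟨hq.2.1.le, hq.2.2.trans hT.2.le⟩)
    ⟨Metric.mem_ball_self hr, hT.1, le_rfl⟩ hF_pos
  exact ⟨x, hxt.1, t, hxt.2, (cutoffVolume_pos_iff hK).1 (hF_pos.trans_le hle), hle, hmax⟩

theorem le_mul_of_four_mul_sq_le {A y : ℝ} (hD : 1 ≤ D) (hA : y - 2 * D ≤ A)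
    (h : 4 * A ^ 2 ≤ 3 * (1 + y ^ 2)) : y ≤ 17 * D := by
  by_contra! hy
  have hsq : (y - 2 * D) ^ 2 ≤ A ^ 2 := pow_le_pow_left₀ (by linarith) hA 2
  nlinarith [mul_pos (show 0 < y by linarith) (sub_pos.2 hy)]

theorem norm_sub_two_mul_le {E : Type*} [NormedAddCommGroup E] [NormedSpace ℝ E] {p x : E}
    {b : ℝ} (hr : 0 < r) (hD : 0 < D) (hx : ‖x‖ ≤ r) (hb : 0 ≤ b) (hbr : b ≤ 1 / r ^ 2) :
    ‖p‖ - 2 * D ≤ r * D * ‖(1 / (r * D)) • p - (2 * b) • x‖ := by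
  have hx_term : ‖(2 * b) • x‖ ≤ 2 / r := calc
    ‖(2 * b) • x‖ = 2 * b * ‖x‖ := by rw [norm_smul, Real.norm_of_nonneg (by positivity)]
    _ ≤ 2 * (1 / r ^ 2) * r := by gcongr
    _ = 2 / r := by field_simp
  have hp_term : ‖(1 / (r * D)) • p‖ = 1 / (r * D) * ‖p‖ := by
    rw [norm_smul, Real.norm_of_nonneg (by positivity)]
  calc ‖p‖ - 2 * D = r * D * (1 / (r * D) * ‖p‖ - 2 / r) := by field_simp
    _ ≤ r * D * (‖(1 / (r * D)) • p‖ - ‖(2 * b) • x‖) := by rw [hp_term]; gcongr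
    _ ≤ r * D * ‖(1 / (r * D)) • p - (2 * b) • x‖ := by gcongr; exact norm_sub_norm_le _ _

theorem four_mul_div_mul_le (hr : 0 < r) (ht : t ∈ Icc 0 (r ^ 2 / (4 * n))) :
    4 * n / r ^ 4 * t ≤ 1 / r ^ 2 := by
  rcases n.eq_zero_or_pos with rfl | hn
  · simp [sq_nonneg]
  have hn' : (0 : ℝ) < n := Nat.cast_pos.2 hn
  calc 4 * n / r ^ 4 * t ≤ 4 * n / r ^ 4 * (r ^ 2 / (4 * n)) := by gcongr; exact ht.2
    _ = 1 / r ^ 2 := by field_simp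

theorem barrier_le_one (hr : 0 < r) (hε : 0 ≤ ε) (ht : t ∈ Icc 0 (r ^ 2 / (4 * n))) :
    barrier (4 * n / r ^ 4) r ε x t ≤ 1 := calc
  barrier (4 * n / r ^ 4) r ε x t ≤ 4 * n / r ^ 4 * t * r ^ 2 - 0 := by
    have := ht.1
    rw [barrier]
    gcongr
    exact sub_le_self _ (sq_nonneg _)
  _ ≤ 1 / r ^ 2 * r ^ 2 - 0 := by gcongr; exact four_mul_div_mul_le hr ht
  _ = 1 := by field_simp; norm_num

-- The slope `4 n / r⁴` makes the barrier rise by exactly `1` at the centre up to time `r² / (4 n)`.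
-- With `D = 1 + 2 M / r`, the factor `1 / (r D)` gives `|α u| ≤ 1 / 2 - 1 / (2 D)`, and
-- `K = 8 n D²` makes the resulting inequality for `|p|` independent of `n` and `r`.
theorem norm_gradient_le_of_isLocalMaxOn (hn : 0 < n) (hr : 0 < r) (hD : 1 ≤ D) (hx : ‖x‖ ≤ r)
    (ht : t ∈ Icc 0 (r ^ 2 / (4 * n))) (hu : ContDiffAt ℝ 3 (uncurry u) (x, t))
    (heq : ∀ᶠ y in 𝓝 x, graphHeat (∇ (u · t) y) u y t = 0)
    (hpos : 0 < tiltedHeight (4 * n / r ^ 4) r β (1 / (r * D)) u x t)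
    (hmax : IsLocalMaxOn
      (uncurry (cutoffVolume (8 * n * D ^ 2) (4 * n / r ^ 4) r β (1 / (r * D)) u))
      (univ ×ˢ Iic t) (x, t)) :
    ‖∇ (u · t) x‖ ≤ 17 * D := by
  obtain ⟨p, hp⟩ : ∃ p, ∇ (u · t) x = p := ⟨_, rfl⟩
  rw [hp]
  have hn' : (0 : ℝ) < n := Nat.cast_pos.2 hn
  have hct := four_mul_div_mul_le hr ht
  refine le_mul_of_four_mul_sq_le hD
    (norm_sub_two_mul_le hr (one_pos.trans_le hD) hx (by have := ht.1; positivity) hct) ?_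
  generalize hA : ‖(1 / (r * D)) • p - (2 * (4 * n / r ^ 4 * t)) • x‖ = A
  have hq := norm_sq_div_le_of_isLocalMaxOn (by positivity) ht.1 (by positivity) hu heq hp hpos
    hmax
  rw [mul_assoc 2, hA] at hq
  have hscaled : (2 * n / r ^ 2) * (4 * (r * D * A) ^ 2 / (1 + ‖p‖ ^ 2)) ≤
      (2 * n / r ^ 2) * 3 := calc
    _ = 8 * n * D ^ 2 * (A ^ 2 / (1 + ‖p‖ ^ 2)) := by field_simp; ring
    _ ≤ 4 * n / r ^ 4 * (r ^ 2 + 2 * n * t) := hq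
    _ = 4 * n / r ^ 2 + 2 * n * (4 * n / r ^ 4 * t) := by field_simp
    _ ≤ 4 * n / r ^ 2 + 2 * n * (1 / r ^ 2) := by gcongr
    _ = (2 * n / r ^ 2) * 3 := by ring
  exact (div_le_iff₀ (by positivity)).1 (le_of_mul_le_mul_left hscaled (by positivity))

theorem volumeElement_le_one_add (f : EuclideanSpace ℝ (Fin n) → ℝ)
    (x : EuclideanSpace ℝ (Fin n)) : volumeElement f x ≤ 1 + ‖∇ f x‖ :=
  Real.sqrt_le_iff.2 ⟨by positivity, by nlinarith [norm_nonneg (∇ f x)]⟩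

theorem mul_volumeElement_le_cutoffVolume {a : ℝ} (ha : a ≤ K * tiltedHeight c r β α u x t) :
    a * volumeElement (u · t) x ≤ cutoffVolume K c r β α u x t :=
  mul_le_mul_of_nonneg_right (ha.trans (le_sub_iff_add_le.2 (Real.add_one_le_exp _)))
    (Real.sqrt_nonneg _)

theorem cutoffVolume_le (hK : 0 ≤ K) (hφ : tiltedHeight c r β α u x t ≤ 1) :
    cutoffVolume K c r β α u x t ≤ Real.exp K * volumeElement (u · t) x := by
  have hexp := Real.exp_le_exp.2 (mul_le_of_le_one_right hK hφ)
  exact mul_le_mul_of_nonneg_right (by linarith) (Real.sqrt_nonneg _)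

theorem four_mul_le_mul_tiltedHeight (hn : 0 < n) (hr : 0 < r) (hD : 0 < D)
    (hα : |1 / (r * D) * u 0 (r ^ 2 / (4 * n))| ≤ 1 / 2 - 1 / (2 * D)) :
    4 * D ≤ 8 * n * D ^ 2 *
      tiltedHeight (4 * n / r ^ 4) r (1 / 2) (1 / (r * D)) u 0 (r ^ 2 / (4 * n)) := by
  have hn' : (1 : ℝ) ≤ n := Nat.one_le_cast.2 hn
  have hcenter : barrier (4 * n / r ^ 4) r (2 * (1 / 2) - 1 / (2 * D))
      (0 : EuclideanSpace ℝ (Fin n)) (r ^ 2 / (4 * n)) = 1 / (2 * D) := by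
    rw [barrier, norm_zero]
    field_simp
    ring
  calc 4 * D ≤ 4 * n * D := by gcongr; linarith
    _ = 8 * n * D ^ 2 * (1 / (2 * D)) := by field_simp; norm_num
    _ ≤ _ := by gcongr; exact hcenter.symm.trans_le (barrier_le_tiltedHeight hα)

theorem volumeElement_le_of_abs_mul_le (hn : 0 < n) (hr : 0 < r) (hD : 1 ≤ D)
    (hu : GraphFlowsByMeanCurvature r u)
    (hα : ∀ x ∈ Metric.ball 0 r, ∀ t ∈ Icc 0 (r ^ 2),
      |1 / (r * D) * u x t| ≤ 1 / 2 - 1 / (2 * D)) :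
    volumeElement (u · (r ^ 2 / (4 * n))) 0 ≤ 10 * Real.exp (8 * n * D ^ 2) := by
  have hn' : (1 : ℝ) ≤ n := Nat.one_le_cast.2 hn
  have hT : r ^ 2 / (4 * n) ∈ Ioo 0 (r ^ 2) :=
    ⟨by positivity, div_lt_self (by positivity) (by linarith)⟩
  have hK : 0 < 8 * n * D ^ 2 := by positivity
  have hcenter := four_mul_le_mul_tiltedHeight hn hr (one_pos.trans_le hD)
    (hα 0 (Metric.mem_ball_self hr) _ (Ioo_subset_Icc_self hT))
  obtain ⟨x, hx, t, ht, hpos, hle, hmax⟩ := exists_isLocalMaxOn_cutoffVolume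
    hr hT hK (by positivity) hu hα
    ((mul_pos_iff_of_pos_left hK).1 ((by positivity : 0 < 4 * D).trans_le hcenter))
  have ht' : t ∈ Ioo 0 (r ^ 2) := ⟨ht.1, ht.2.trans_lt hT.2⟩
  have heq : ∀ᶠ y in 𝓝 x, graphHeat (∇ (u · t) y) u y t = 0 :=
    (Metric.isOpen_ball.eventually_mem hx).mono fun y hy => hu.graphHeat_self hy ht'
  have hgrad : ‖∇ (u · t) x‖ ≤ 17 * D :=
    norm_gradient_le_of_isLocalMaxOn hn hr hD (mem_ball_zero_iff.1 hx).le (Ioc_subset_Icc_self ht)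
      (hu.contDiffAt 3 hx ht') heq hpos hmax
  have hheight : tiltedHeight (4 * n / r ^ 4) r (1 / 2) (1 / (r * D)) u x t ≤ 1 :=
    (tiltedHeight_le_barrier (hα x hx t (Ioo_subset_Icc_self ht'))).trans
      (barrier_le_one hr (by positivity) (Ioc_subset_Icc_self ht))
  have hchain : 4 * D * volumeElement (u · (r ^ 2 / (4 * n))) 0 ≤
      4 * D * (10 * Real.exp (8 * n * D ^ 2)) := calc
    _ ≤ cutoffVolume (8 * n * D ^ 2) (4 * n / r ^ 4) r (1 / 2) (1 / (r * D)) u 0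
          (r ^ 2 / (4 * n)) := mul_volumeElement_le_cutoffVolume hcenter
    _ ≤ _ := hle
    _ ≤ Real.exp (8 * n * D ^ 2) * volumeElement (u · t) x :=
      cutoffVolume_le hK.le hheight
    _ ≤ Real.exp (8 * n * D ^ 2) * (40 * D) := by
      gcongr
      linarith [volumeElement_le_one_add (u · t) x]
    _ = _ := by ring
  exact le_of_mul_le_mul_left hchain (by positivity)

theorem GraphFlowsByMeanCurvature.volumeElement_le {M : ℝ} (hn : 0 < n) (hr : 0 < r)
    (hu : GraphFlowsByMeanCurvature r u)
    (hM : ∀ x ∈ Metric.ball 0 r, ∀ t ∈ Icc 0 (r ^ 2), |u x t| ≤ M) :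
    volumeElement (u · (r ^ 2 / (4 * n))) 0 ≤ 10 * Real.exp (8 * n * (1 + 2 * M / r) ^ 2) := by
  have hM_nonneg : 0 ≤ M :=
    (abs_nonneg _).trans (hM 0 (Metric.mem_ball_self hr) 0 ⟨le_rfl, sq_nonneg r⟩)
  refine volumeElement_le_of_abs_mul_le hn hr (le_add_of_nonneg_right (by positivity)) hu
    fun x hx t ht => ?_
  calc |1 / (r * (1 + 2 * M / r)) * u x t|
      = 1 / (r * (1 + 2 * M / r)) * |u x t| := by rw [abs_mul, abs_of_pos (by positivity)]
    _ ≤ 1 / (r * (1 + 2 * M / r)) * M := by gcongr; exact hM x hx t ht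
    _ = 1 / 2 - 1 / (2 * (1 + 2 * M / r)) := by field_simp; ring

end Estimate

section SupNorm

variable {n : ℕ} {r M t : ℝ} {x : EuclideanSpace ℝ (Fin n)}
  {u : EuclideanSpace ℝ (Fin n) → ℝ → ℝ}

theorem abs_le_toReal_supNorm (h : supNorm r u ≠ ⊤) (hx : x ∈ Metric.ball 0 r)
    (ht : t ∈ Icc 0 (r ^ 2)) : |u x t| ≤ (supNorm r u).toReal :=
  (ENNReal.ofReal_le_iff_le_toReal h).1 (le_iSup₂_of_le x hx (le_iSup₂_of_le t ht le_rfl))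

theorem GraphFlowsByMeanCurvature.log_one_add_norm_gradient_sq_le (hn : 0 < n) (hr : 0 < r)
    (hu : GraphFlowsByMeanCurvature r u)
    (hM : ∀ x ∈ Metric.ball 0 r, ∀ t ∈ Icc 0 (r ^ 2), |u x t| ≤ M) :
    Real.log (1 + ‖∇ (u · (r ^ 2 / (4 * n))) 0‖ ^ 2) ≤
      2 * Real.log 10 + 16 * n * (1 + 2 * r⁻¹ * M) ^ 2 := by
  have hlog := Real.log_le_log (one_pos.trans_le (one_le_volumeElement _ _))
    (hu.volumeElement_le hn hr hM)
  rw [volumeElement, Real.log_sqrt (by positivity), Real.log_mul (by norm_num) (Real.exp_ne_zero _),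
    Real.log_exp] at hlog
  rw [show 2 * r⁻¹ * M = 2 * M / r by ring]
  linarith

theorem ofReal_add_mul_one_add_sq {a b : ℝ} (ha : 0 ≤ a) (hr : 0 < r) (hb : 0 ≤ b) (n : ℕ) :
    ENNReal.ofReal (a + 16 * n * (1 + 2 * r⁻¹ * b) ^ 2) =
      ENNReal.ofReal a +
        16 * (n : ℝ≥0∞) * (1 + 2 * (ENNReal.ofReal r)⁻¹ * ENNReal.ofReal b) ^ 2 := by
  rw [ENNReal.ofReal_add ha (by positivity), ENNReal.ofReal_mul (by positivity),
    ENNReal.ofReal_mul (by norm_num), ENNReal.ofReal_pow (by positivity),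
    ENNReal.ofReal_add (by norm_num) (by positivity), ENNReal.ofReal_mul (by positivity),
    ENNReal.ofReal_mul (by norm_num), ENNReal.ofReal_inv_of_pos hr]
  simp

end SupNorm

end GraphMCF

/-- Interior gradient estimate for graphs flowing by mean curvature. Both sides are written in
`[0, ∞]`; the real numbers `log (1 + |du|²)`, `2 log 10` and `r` are nonnegative, so that
`ENNReal.ofReal` loses nothing. -/
theorem proposition2p1 (n : ℕ) (hn : 1 ≤ n) (r : ℝ) (hr : 0 < r)
    (u : EuclideanSpace ℝ (Fin n) → ℝ → ℝ)
    (hu : GraphMCF.GraphFlowsByMeanCurvature r u) :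
    ENNReal.ofReal
        (Real.log (1 + ‖gradient (fun x => u x (r ^ 2 / (4 * (n : ℝ)))) 0‖ ^ 2)) ≤
      ENNReal.ofReal (2 * Real.log 10) +
        16 * (n : ℝ≥0∞) * (1 + 2 * (ENNReal.ofReal r)⁻¹ * GraphMCF.supNorm r u) ^ 2 := by
  by_cases htop : GraphMCF.supNorm r u = ⊤
  · have hn0 : n ≠ 0 := Nat.one_le_iff_ne_zero.1 hn
    simp [htop, ENNReal.mul_top, hn0]
  · have hlog := hu.log_one_add_norm_gradient_sq_le hn hr
      fun x hx t ht => GraphMCF.abs_le_toReal_supNorm htop hx ht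
    have hlog10 : 0 ≤ 2 * Real.log 10 := by positivity
    rw [← ENNReal.ofReal_toReal htop,
      ← GraphMCF.ofReal_add_mul_one_add_sq hlog10 hr ENNReal.toReal_nonneg]
    exact ENNReal.ofReal_le_ofReal hlog
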